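/- For real $\nu \ge 0$ and an integer $n \ge 1$, let $j_{\nu,n}$ denote the $n$-th positive zero (in increasing order) of the Bessel function of the first kind $J_\nu$. For integers $k \ge 1$ and $d \ge 2$ set $$c(k,d) := \begin{cases} \dfrac{\pi^2 k^2}{\left(2 j_{0,1} + \pi (k-1)\right)^2} & \text{if } d = 2,\\[2ex] \dfrac{\pi^2 k^2}{4\, j_{d/2-1,\,(k+1)/2}^2} & \text{if } d \ge 3 \text{ and } k \text{ is odd},\\[2ex] \dfrac{\pi^2 k^2}{\left(j_{d/2-1,\,k/2} + j_{d/2-1,\,k/2+1}\right)^2} & \text{if } d \ge 3 \text{ and } k \text{ is even}.\end{cases}$$ Then: 1. $c(k,d) < 1$ for all integers $k \ge 1$ and $d \ge 2$; 2. for each fixed integer $d \ge 2$, $c(k,d) \to 1$ as $k \to \infty$; 3. for each fixed integer $k \ge 1$ there exists a constant $C_k > 0$ (depending only on $k$) such that $c(k,d) \le \dfrac{C_k}{d^2}$ for all integers $d \ge 2$. -/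

import Mathlib

/-- The Bessel function of the first kind `J_ν(x)`, of real order `ν`, at a real argument `x > 0`:
`J_ν(x) = ∑_{m ≥ 0} (-1)^m / (m! Γ(m + ν + 1)) (x / 2)^(2 m + ν)`. The series converges for all
`ν` and `x`, and it is only used for `x > 0`. -/
noncomputable def besselJ (ν x : ℝ) : ℝ :=
  (x / 2) ^ ν * ∑' m : ℕ,
    (-1 : ℝ) ^ m / ((m.factorial : ℝ) * Real.Gamma ((m : ℝ) + ν + 1)) * (x / 2) ^ (2 * m)

/-- The set of positive zeros of `J_ν`. -/
def besselZeros (ν : ℝ) : Set ℝ := {x | 0 < x ∧ besselJ ν x = 0}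

/-- `x` is the `n`-th positive zero of `J_ν` (for `n ≥ 1`): it is a positive zero, and exactly `n`
positive zeros are at most `x`. (The positive zeros of `J_ν` are simple, so that there is no
multiplicity to count. For `n ≥ 1` the condition on `ncard` includes finiteness.) -/
def IsBesselZero (ν : ℝ) (n : ℕ) (x : ℝ) : Prop :=
  x ∈ besselZeros ν ∧ (besselZeros ν ∩ Set.Iic x).ncard = n

/-- There is at most one `n`-th positive zero. -/
theorem IsBesselZero.unique {ν : ℝ} {n : ℕ} (hn : 1 ≤ n) {x y : ℝ}
    (hx : IsBesselZero ν n x) (hy : IsBesselZero ν n y) : x = y := by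
  have key : ∀ {a b : ℝ}, IsBesselZero ν n a → IsBesselZero ν n b → b ≤ a := by
    intro a b ha hb
    by_contra! hlt
    have hfin : (besselZeros ν ∩ Set.Iic b).Finite :=
      Set.finite_of_ncard_ne_zero (by rw [hb.2]; omega)
    have hsub : besselZeros ν ∩ Set.Iic a ⊂ besselZeros ν ∩ Set.Iic b := by
      refine ⟨fun z hz => ⟨hz.1, le_trans hz.2 hlt.le⟩, fun h => ?_⟩
      exact absurd (h ⟨hb.1, le_refl b⟩).2 (not_le.mpr hlt)
    have := Set.ncard_lt_ncard hsub hfin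
    rw [ha.2, hb.2] at this
    exact lt_irrefl _ this
  exact le_antisymm (key hy hx) (key hx hy)

/-- `j_{ν,n}`, the `n`-th positive zero of `J_ν` in increasing order, for `n ≥ 1`
(the infimum is over a set with at most one element). -/
noncomputable def besselZero (ν : ℝ) (n : ℕ) : ℝ := sInf {x | IsBesselZero ν n x}

/-- `besselZero ν n` is the `n`-th positive zero. -/
theorem IsBesselZero.besselZero_eq {ν : ℝ} {n : ℕ} (hn : 1 ≤ n) {x : ℝ}
    (hx : IsBesselZero ν n x) : besselZero ν n = x := by
  have : {y | IsBesselZero ν n y} = {x} := by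
    ext y
    exact ⟨fun hy => IsBesselZero.unique hn hy hx, fun hy => by rw [Set.mem_singleton_iff.mp hy]; exact hx⟩
  rw [besselZero, this, csInf_singleton]

/-- The bound `c(k, d)`, for `k ≥ 1` and `d ≥ 2`. The divisions `(k + 1) / 2` and `k / 2` of natural
numbers are exact in the cases where they occur. -/
noncomputable def krogerBound (k d : ℕ) : ℝ :=
  if d = 2 then
    Real.pi ^ 2 * (k : ℝ) ^ 2 / (2 * besselZero 0 1 + Real.pi * ((k : ℝ) - 1)) ^ 2
  else if Odd k then
    Real.pi ^ 2 * (k : ℝ) ^ 2 / (4 * besselZero ((d : ℝ) / 2 - 1) ((k + 1) / 2) ^ 2)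
  else
    Real.pi ^ 2 * (k : ℝ) ^ 2 /
      (besselZero ((d : ℝ) / 2 - 1) (k / 2) + besselZero ((d : ℝ) / 2 - 1) (k / 2 + 1)) ^ 2

/-! Write `c(k,d) = (πk / D)²` with `D = krogerDenom k d`; everything reduces to bounds on Bessel
zeros. A multiple of `√x J_ν` solves `u'' + q u = 0` with `q = 1 - (ν² - 1/4)/x²`, so Sturm theory
applies. The case `d ≥ 3` means `ν ≥ 1/2`.

Since `q ≤ 1`, zeros are at least `π` apart, counting the zero at the origin (`pi_le_gap`), so
`j_{ν,n} ≥ πn`. The indices in `D` add up to `k + 1`, hence `D > πk`. For `d = 2` it is enough that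
`2 j_{0,1} ≥ 4 > π`. Since `q → 1`, gaps are eventually at most `π + ε`
(`exists_besselNormal_zero_of_large`), so `D / k → π`. Since `q ≤ 0` before the turning point, no
zero lies there (`turning_point_lt_sq`); thus `D` grows linearly in `d`. -/

/-! ### Power series: derivative, recurrence, positivity -/

/-- The power series `∑ (-1)^m t^m / (m! Γ(m + ν + 1))`, the entire factor of `J_ν` in the
variable `t = x² / 4`. -/
noncomputable def besselSeries (ν t : ℝ) : ℝ :=
  ∑' m : ℕ, (-1 : ℝ) ^ m / ((m.factorial : ℝ) * Real.Gamma ((m : ℝ) + ν + 1)) * t ^ m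

lemma besselJ_eq (ν x : ℝ) : besselJ ν x = (x / 2) ^ ν * besselSeries ν (x ^ 2 / 4) := by
  unfold besselJ besselSeries
  congr 1
  refine tsum_congr fun m => ?_
  rw [pow_mul]
  ring_nf

lemma Gamma_le_Gamma_nat_add {ν : ℝ} (hν : 0 ≤ ν) (m : ℕ) :
    Real.Gamma (ν + 1) ≤ Real.Gamma ((m : ℝ) + ν + 1) := by
  induction m with
  | zero => simp
  | succ m ih =>
    have hm : (0 : ℝ) ≤ m := m.cast_nonneg
    have h : Real.Gamma (((m + 1 : ℕ) : ℝ) + ν + 1)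
        = ((m : ℝ) + ν + 1) * Real.Gamma ((m : ℝ) + ν + 1) := by
      rw [← Real.Gamma_add_one (by positivity)]
      push_cast
      ring_nf
    rw [h]
    have := Real.Gamma_pos_of_pos (show 0 < (m : ℝ) + ν + 1 by positivity)
    nlinarith

lemma norm_besselCoeff_le {ν : ℝ} (hν : 0 ≤ ν) (m : ℕ) :
    ‖(-1 : ℝ) ^ m / ((m.factorial : ℝ) * Real.Gamma ((m : ℝ) + ν + 1))‖
      ≤ (Real.Gamma (ν + 1))⁻¹ * (m.factorial : ℝ)⁻¹ := by
  have h0 := Real.Gamma_pos_of_pos (show 0 < ν + 1 by positivity)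
  have h1 := Gamma_le_Gamma_nat_add hν m
  have h2 : (0 : ℝ) < m.factorial := by positivity
  rw [norm_div, norm_pow, norm_neg, norm_one, one_pow, Real.norm_of_nonneg (by positivity),
    ← mul_inv, one_div, mul_comm]
  gcongr

lemma summable_besselSeries {ν : ℝ} (hν : 0 ≤ ν) (t : ℝ) :
    Summable fun m : ℕ =>
      (-1 : ℝ) ^ m / ((m.factorial : ℝ) * Real.Gamma ((m : ℝ) + ν + 1)) * t ^ m := by
  refine Summable.of_norm_bounded
    (g := fun m : ℕ => (Real.Gamma (ν + 1))⁻¹ * (|t| ^ m / (m.factorial : ℝ)))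
    ((Real.summable_pow_div_factorial |t|).mul_left _) fun m => ?_
  rw [norm_mul, norm_pow, Real.norm_eq_abs t]
  calc _ ≤ (Real.Gamma (ν + 1))⁻¹ * (m.factorial : ℝ)⁻¹ * |t| ^ m := by
        gcongr
        exact norm_besselCoeff_le hν m
    _ = _ := by ring

lemma hasDerivAt_besselSeries {ν : ℝ} (hν : 0 ≤ ν) (t : ℝ) :
    HasDerivAt (besselSeries ν) (-besselSeries (ν + 1) t) t := by
  have h0 := Real.Gamma_pos_of_pos (show 0 < ν + 1 by positivity)
  set R : ℝ := |t| + 1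
  have hR : 0 ≤ R := by positivity
  set u : ℕ → ℝ := fun m =>
    (Real.Gamma (ν + 1))⁻¹ * (m.factorial : ℝ)⁻¹ * ((m : ℝ) * R ^ (m - 1))
  have hu : Summable u := by
    rw [← summable_nat_add_iff 1]
    refine ((Real.summable_pow_div_factorial R).mul_left (Real.Gamma (ν + 1))⁻¹).congr
      fun m => ?_
    simp only [u, Nat.factorial_succ]
    push_cast
    field_simp
  have key := hasDerivAt_tsum_of_isPreconnected (t := Metric.ball (0 : ℝ) R) (y := t) (y₀ := t)
    (g := fun (m : ℕ) (y : ℝ) =>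
      (-1 : ℝ) ^ m / ((m.factorial : ℝ) * Real.Gamma ((m : ℝ) + ν + 1)) * y ^ m)
    (g' := fun (m : ℕ) (y : ℝ) =>
      (-1 : ℝ) ^ m / ((m.factorial : ℝ) * Real.Gamma ((m : ℝ) + ν + 1)) * (m * y ^ (m - 1)))
    hu Metric.isOpen_ball (convex_ball _ _).isPreconnected
    (fun m y _ => (hasDerivAt_pow m y).const_mul _)
    (fun m y hy => by
      have hy' : |y| ≤ R := by
        have := Metric.mem_ball.mp hy
        rw [Real.dist_eq, sub_zero] at this
        exact this.le
      rw [norm_mul, norm_mul, norm_pow, Real.norm_eq_abs y, Real.norm_natCast]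
      simp only [u]
      gcongr
      exact norm_besselCoeff_le hν m)
    (by simp [R]) (summable_besselSeries hν t) (by simp [R])
  have hs : Summable fun m : ℕ =>
      (-1 : ℝ) ^ m / ((m.factorial : ℝ) * Real.Gamma ((m : ℝ) + ν + 1)) * (m * t ^ (m - 1)) := by
    refine Summable.of_norm_bounded hu fun m => ?_
    rw [norm_mul, norm_mul, norm_pow, Real.norm_eq_abs t, Real.norm_natCast]
    simp only [u]
    gcongr
    · exact norm_besselCoeff_le hν m
    · simp [R]
  have hval : -besselSeries (ν + 1) t = ∑' m : ℕ,
      (-1 : ℝ) ^ m / ((m.factorial : ℝ) * Real.Gamma ((m : ℝ) + ν + 1)) * (m * t ^ (m - 1)) := by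
    rw [hs.tsum_eq_zero_add]
    simp only [Nat.cast_zero, zero_mul, mul_zero, zero_add, besselSeries]
    rw [← tsum_neg]
    refine tsum_congr fun m => ?_
    have : ((m + 1 : ℕ) : ℝ) + ν + 1 = (m : ℝ) + (ν + 1) + 1 := by push_cast; ring
    rw [this, Nat.factorial_succ, Nat.add_sub_cancel]
    have hG := Real.Gamma_pos_of_pos (show 0 < (m : ℝ) + (ν + 1) + 1 by positivity)
    push_cast
    field_simp
    ring
  rw [hval]
  exact key

/-- Comparison of coefficients. Combined with `g_ν' = -g_{ν+1}`, this is the Bessel equation `t g''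
+ (ν + 1) g' + g = 0`. -/
lemma besselSeries_recurrence {ν : ℝ} (hν : 0 ≤ ν) (t : ℝ) :
    besselSeries ν t
      = (ν + 1) * besselSeries (ν + 1) t - t * besselSeries (ν + 2) t := by
  have s0 := summable_besselSeries hν t
  have s1 := summable_besselSeries (show 0 ≤ ν + 1 by positivity) t
  have s2 := summable_besselSeries (show 0 ≤ ν + 2 by positivity) t
  have s1' := (summable_nat_add_iff 1).mpr s1
  unfold besselSeries
  rw [s0.tsum_eq_zero_add, s1.tsum_eq_zero_add, mul_add, ← tsum_mul_left, ← tsum_mul_left,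
    add_sub_assoc, ← (s1'.mul_left _).tsum_sub (s2.mul_left _)]
  congr 1
  · have h := Real.Gamma_add_one (show ν + 1 ≠ 0 by positivity)
    have hG := Real.Gamma_pos_of_pos (show 0 < ν + 1 by positivity)
    simp only [Nat.cast_zero, zero_add, h]
    field_simp
  · refine tsum_congr fun m => ?_
    have e0 : ((m + 1 : ℕ) : ℝ) + ν + 1 = (m : ℝ) + ν + 2 := by push_cast; ring
    have e1 : ((m + 1 : ℕ) : ℝ) + (ν + 1) + 1 = (m : ℝ) + ν + 2 + 1 := by push_cast; ring
    have e2 : (m : ℝ) + (ν + 2) + 1 = (m : ℝ) + ν + 2 + 1 := by ring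
    have h := Real.Gamma_add_one (show (m : ℝ) + ν + 2 ≠ 0 by positivity)
    have hG := Real.Gamma_pos_of_pos (show 0 < (m : ℝ) + ν + 2 by positivity)
    rw [e0, e1, e2, h, Nat.factorial_succ]
    push_cast
    field_simp
    ring

lemma besselSeries_pos {ν t : ℝ} (hν : 0 ≤ ν) (ht : 0 ≤ t) (htν : t < ν + 1) :
    0 < besselSeries ν t := by
  set f : ℕ → ℝ := fun m => t ^ m / ((m.factorial : ℝ) * Real.Gamma ((m : ℝ) + ν + 1))
  have hsum : HasSum (fun m => (-1 : ℝ) ^ m * f m) (besselSeries ν t) := by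
    refine (summable_besselSeries hν t).hasSum.congr_fun ?_
    intro m
    simp only [f]
    ring
  have hanti : Antitone f := by
    refine antitone_nat_of_succ_le fun m => ?_
    have e0 : ((m + 1 : ℕ) : ℝ) + ν + 1 = (m : ℝ) + ν + 1 + 1 := by push_cast; ring
    have h := Real.Gamma_add_one (show (m : ℝ) + ν + 1 ≠ 0 by positivity)
    have hG := Real.Gamma_pos_of_pos (show 0 < (m : ℝ) + ν + 1 by positivity)
    simp only [f]
    rw [e0, h, Nat.factorial_succ, div_le_div_iff₀ (by positivity) (by positivity)]
    have hm : (0 : ℝ) ≤ m := m.cast_nonneg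
    have : t ≤ ((m : ℝ) + 1) * (m + ν + 1) := by nlinarith
    push_cast
    calc t ^ (m + 1) * ((m.factorial : ℝ) * Real.Gamma ((m : ℝ) + ν + 1))
        = t * (t ^ m * ((m.factorial : ℝ) * Real.Gamma ((m : ℝ) + ν + 1))) := by ring
      _ ≤ ((m : ℝ) + 1) * (m + ν + 1) *
          (t ^ m * ((m.factorial : ℝ) * Real.Gamma ((m : ℝ) + ν + 1))) := by gcongr
      _ = _ := by ring
  -- The terms decrease, so the two-term partial sum, positive for `t < ν + 1`, is a lower bound.
  have hle := hanti.alternating_series_le_tendsto hsum.tendsto_sum_nat 1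
  refine lt_of_lt_of_le ?_ hle
  have h := Real.Gamma_add_one (show ν + 1 ≠ 0 by positivity)
  have hG := Real.Gamma_pos_of_pos (show 0 < ν + 1 by positivity)
  have e : (1 : ℝ) + ν + 1 = ν + 1 + 1 := by ring
  simp only [f, mul_one, Finset.sum_range_succ, Finset.sum_range_zero, Nat.cast_zero,
    Nat.cast_one, zero_add, pow_zero, pow_one, Nat.factorial, e, h]
  have : 1 / Real.Gamma (ν + 1) - t / ((ν + 1) * Real.Gamma (ν + 1))
      = (ν + 1 - t) / ((ν + 1) * Real.Gamma (ν + 1)) := by field_simp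
  have h2 : 0 < (ν + 1 - t) / ((ν + 1) * Real.Gamma (ν + 1)) :=
    div_pos (by linarith) (by positivity)
  calc 0 < _ := h2
    _ = _ := by rw [← this]; ring

/-- Zeros of the Bessel series at positive arguments are simple. -/
lemma besselSeries_succ_ne_zero {ν t : ℝ} (hν : 0 ≤ ν) (ht : 0 < t)
    (h : besselSeries ν t = 0) : besselSeries (ν + 1) t ≠ 0 := by
  intro h1
  -- A common zero propagates through the recurrence to all orders `ν + n`, but the series is
  -- positive once `ν + n + 1 > t`.
  have key : ∀ n : ℕ, besselSeries (ν + n) t = 0 ∧ besselSeries (ν + n + 1) t = 0 := by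
    intro n
    induction n with
    | zero => simpa using ⟨h, h1⟩
    | succ n ih =>
      have hr := besselSeries_recurrence (show 0 ≤ ν + n by positivity) t
      rw [ih.1, ih.2] at hr
      push_cast
      rw [← add_assoc]
      refine ⟨ih.2, ?_⟩
      have : t * besselSeries (ν + n + 2) t = 0 := by linarith
      rw [add_assoc, one_add_one_eq_two]
      exact (mul_eq_zero.mp this).resolve_left ht.ne'
  obtain ⟨n, hn⟩ := exists_nat_gt t
  have := besselSeries_pos (show 0 ≤ ν + n by positivity) ht.le (by linarith)
  exact this.ne' (key n).1

/-! ### Normal form and its differential equation -/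

/-- The normal form `x^(ν + 1/2) g_ν(x² / 4)`, a constant multiple of `√x J_ν(x)`. -/
noncomputable def besselNormal (ν x : ℝ) : ℝ :=
  x ^ (ν + 1 / 2) * besselSeries ν (x ^ 2 / 4)

/-- The derivative of `besselNormal`. -/
noncomputable def besselNormalDeriv (ν x : ℝ) : ℝ :=
  (ν + 1 / 2) * x ^ (ν - 1 / 2) * besselSeries ν (x ^ 2 / 4)
    - x ^ (ν + 1 / 2) * (x / 2 * besselSeries (ν + 1) (x ^ 2 / 4))

lemma continuous_besselSeries {ν : ℝ} (hν : 0 ≤ ν) : Continuous (besselSeries ν) :=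
  continuous_iff_continuousAt.mpr fun t => (hasDerivAt_besselSeries hν t).continuousAt

lemma hasDerivAt_besselSeries_sq {ν : ℝ} (hν : 0 ≤ ν) (x : ℝ) :
    HasDerivAt (fun y => besselSeries ν (y ^ 2 / 4))
      (-(x / 2 * besselSeries (ν + 1) (x ^ 2 / 4))) x := by
  have h : HasDerivAt (fun y : ℝ => y ^ 2 / 4) (x / 2) x := by
    refine HasDerivAt.congr_deriv ((hasDerivAt_pow 2 x).div_const 4) ?_
    norm_num
    ring
  have hc := HasDerivAt.comp (h := fun y : ℝ => y ^ 2 / 4) x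
    (hasDerivAt_besselSeries hν (x ^ 2 / 4)) h
  refine hc.congr_deriv ?_
  ring

lemma hasDerivAt_besselNormal {ν x : ℝ} (hν : 0 ≤ ν) (hx : 0 < x) :
    HasDerivAt (besselNormal ν) (besselNormalDeriv ν x) x := by
  have h1 := Real.hasDerivAt_rpow_const (x := x) (p := ν + 1 / 2) (Or.inl hx.ne')
  refine HasDerivAt.congr_deriv (h1.mul (hasDerivAt_besselSeries_sq hν x)) ?_
  rw [show ν + 1 / 2 - 1 = ν - 1 / 2 by ring, besselNormalDeriv]
  ring

lemma hasDerivAt_besselNormalDeriv {ν x : ℝ} (hν : 0 ≤ ν) (hx : 0 < x) :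
    HasDerivAt (besselNormalDeriv ν)
      (-(1 - (ν ^ 2 - 1 / 4) / x ^ 2) * besselNormal ν x) x := by
  have h1 := Real.hasDerivAt_rpow_const (x := x) (p := ν + 1 / 2) (Or.inl hx.ne')
  have h2 := Real.hasDerivAt_rpow_const (x := x) (p := ν - 1 / 2) (Or.inl hx.ne')
  have h3 := hasDerivAt_besselSeries_sq hν x
  have h4 := hasDerivAt_besselSeries_sq (show 0 ≤ ν + 1 by positivity) x
  have h5 : HasDerivAt (fun y : ℝ => y / 2) (1 / 2) x := (hasDerivAt_id x).div_const 2
  refine HasDerivAt.congr_deriv (((h2.const_mul (ν + 1 / 2)).mul h3).sub (h1.mul (h5.mul h4))) ?_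
  have hr := besselSeries_recurrence hν (x ^ 2 / 4)
  -- With `x^(ν - 3/2)` as the only real power, the claim is a multiple of the recurrence.
  have e1 : x ^ (ν - 1 / 2) = x ^ (ν - 3 / 2) * x := by
    rw [← Real.rpow_add_one hx.ne']; ring_nf
  have e2 : x ^ (ν + 1 / 2) = x ^ (ν - 3 / 2) * x * x := by
    rw [← Real.rpow_add_one hx.ne', ← Real.rpow_add_one hx.ne']; ring_nf
  rw [show ν + 1 / 2 - 1 = ν - 1 / 2 by ring, show ν - 1 / 2 - 1 = ν - 3 / 2 by ring,
    show ν + 1 + 1 = ν + 2 by ring, besselNormal, e1, e2]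
  set g := besselSeries ν (x ^ 2 / 4)
  set g1 := besselSeries (ν + 1) (x ^ 2 / 4)
  set g2 := besselSeries (ν + 2) (x ^ 2 / 4)
  field_simp
  linear_combination (16 * x ^ 2) * hr

lemma continuous_besselNormal {ν : ℝ} (hν : 0 ≤ ν) : Continuous (besselNormal ν) := by
  have := continuous_besselSeries hν
  have h := Real.continuous_rpow_const (show 0 ≤ ν + 1 / 2 by positivity)
  unfold besselNormal
  fun_prop

/-- For `ν ≥ 1/2` the exponent `ν - 1/2` is nonnegative, so continuity includes the origin and
comparison arguments may start there. -/
lemma continuous_besselNormalDeriv {ν : ℝ} (hν : 1 / 2 ≤ ν) :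
    Continuous (besselNormalDeriv ν) := by
  have := continuous_besselSeries (show 0 ≤ ν by linarith)
  have := continuous_besselSeries (show 0 ≤ ν + 1 by linarith)
  have h := Real.continuous_rpow_const (show 0 ≤ ν + 1 / 2 by linarith)
  have h := Real.continuous_rpow_const (show 0 ≤ ν - 1 / 2 by linarith)
  unfold besselNormalDeriv
  fun_prop

lemma besselNormal_eq_zero_iff {ν x : ℝ} (hx : 0 < x) :
    besselNormal ν x = 0 ↔ besselSeries ν (x ^ 2 / 4) = 0 := by
  simp [besselNormal, (Real.rpow_pos_of_pos hx _).ne']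

lemma mem_besselZeros_iff {ν x : ℝ} :
    x ∈ besselZeros ν ↔ 0 < x ∧ besselNormal ν x = 0 := by
  refine and_congr_right fun hx => ?_
  rw [besselNormal_eq_zero_iff hx, besselJ_eq]
  simp [(Real.rpow_pos_of_pos (half_pos hx) _).ne']

lemma besselNormalDeriv_ne_zero {ν x : ℝ} (hν : 0 ≤ ν) (hx : 0 < x)
    (h : besselNormal ν x = 0) : besselNormalDeriv ν x ≠ 0 := by
  rw [besselNormal_eq_zero_iff hx] at h
  have h1 := besselSeries_succ_ne_zero hν (by positivity) h
  simp [besselNormalDeriv, h, h1, (Real.rpow_pos_of_pos hx _).ne', hx.ne']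

/-! ### Sturm theory -/

/-- Disconjugacy: if the Riccati inequality `r' + r² + q ≤ 0` has a solution on an interval,
then `u'' + q u = 0` has no solution with two zeros there. -/
lemma no_two_zeros_of_riccati {u v q r r' : ℝ → ℝ} {a b : ℝ} (hab : a < b)
    (hu : ContinuousOn u (Set.Icc a b)) (hv : ContinuousOn v (Set.Icc a b))
    (hr : ContinuousOn r (Set.Icc a b))
    (hu' : ∀ x ∈ Set.Ioc a b, HasDerivAt u (v x) x)
    (hv' : ∀ x ∈ Set.Ioc a b, HasDerivAt v (-q x * u x) x)
    (hr' : ∀ x ∈ Set.Ioc a b, HasDerivAt r (r' x) x)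
    (hric : ∀ x ∈ Set.Ioc a b, r' x + r x ^ 2 + q x ≤ 0)
    (hua : u a = 0) (hub : u b = 0) : v b = 0 := by
  -- `F' = (v - u r)² - u² (r' + r² + q) ≥ 0` and `F` vanishes at both ends, so `F = 0` throughout;
  -- its one-sided derivative at `b` is `v(b)²`.
  set F : ℝ → ℝ := fun x => u x * v x - u x ^ 2 * r x
  have hF : ∀ x ∈ Set.Ioc a b,
      HasDerivAt F ((v x - u x * r x) ^ 2 - u x ^ 2 * (r' x + r x ^ 2 + q x)) x := by
    intro x hx
    have h := ((hu' x hx).mul (hv' x hx)).sub (((hu' x hx).pow 2).mul (hr' x hx))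
    refine HasDerivAt.congr_deriv (h) ?_
    simp only [Pi.pow_apply]
    push_cast
    ring
  have hmono : MonotoneOn F (Set.Icc a b) := by
    refine monotoneOn_of_deriv_nonneg (convex_Icc a b)
      ((hu.mul hv).sub ((hu.pow 2).mul hr)) ?_ ?_
    · rw [interior_Icc]
      exact fun x hx => (hF x ⟨hx.1, hx.2.le⟩).differentiableAt.differentiableWithinAt
    · rw [interior_Icc]
      intro x hx
      have hx' : x ∈ Set.Ioc a b := ⟨hx.1, hx.2.le⟩
      rw [(hF x hx').deriv]
      nlinarith [sq_nonneg (v x - u x * r x), sq_nonneg (u x), hric x hx']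
  have hFa : F a = 0 := by simp [F, hua]
  have hFb : F b = 0 := by simp [F, hub]
  have hzero : ∀ x ∈ Set.Icc a b, F x = 0 := fun x hx =>
    le_antisymm (hFb ▸ hmono hx (Set.right_mem_Icc.mpr hab.le) hx.2)
      (hFa ▸ hmono (Set.left_mem_Icc.mpr hab.le) hx hx.1)
  have hb := (hF b ⟨hab, le_rfl⟩).hasDerivWithinAt (s := Set.Icc a b)
  have h0 : HasDerivWithinAt F 0 (Set.Icc a b) b :=
    (hasDerivWithinAt_const b _ (0 : ℝ)).congr hzero hFb
  have := (uniqueDiffOn_Icc hab b (Set.right_mem_Icc.mpr hab.le)).eq_deriv _ hb h0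
  simpa [hub] using this

/-- Sturm comparison: if `q ≥ ω²` then a solution of `u'' + q u = 0` vanishes in every closed
interval of length `π / ω`. -/
lemma exists_zero_of_le_potential {u v q : ℝ → ℝ} {a ω : ℝ} (hω : 0 < ω)
    (hu : ∀ x ∈ Set.Icc a (a + Real.pi / ω), HasDerivAt u (v x) x)
    (hv : ∀ x ∈ Set.Icc a (a + Real.pi / ω), HasDerivAt v (-q x * u x) x)
    (hq : ∀ x ∈ Set.Icc a (a + Real.pi / ω), ω ^ 2 ≤ q x) :
    ∃ x ∈ Set.Icc a (a + Real.pi / ω), u x = 0 := by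
  have hlen : 0 < Real.pi / ω := div_pos Real.pi_pos hω
  set b := a + Real.pi / ω with hb
  have hab : a ≤ b := by linarith
  by_contra! hne
  have hcont : ContinuousOn u (Set.Icc a b) :=
    fun x hx => (hu x hx).continuousAt.continuousWithinAt
  have hsign : 0 < u a * u b ∧ ∀ x ∈ Set.Icc a b, 0 ≤ u a * u x := by
    have h : ∀ x ∈ Set.Icc a b, 0 < u a * u x := by
      intro x hx
      by_contra! hneg
      have hsub : Set.Icc a x ⊆ Set.Icc a b := Set.Icc_subset_Icc_right hx.2
      have hua := hne a (Set.left_mem_Icc.mpr hab)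
      have h0 : (0 : ℝ) ∈ Set.uIcc (u a) (u x) := by
        rw [Set.mem_uIcc]
        rcases lt_or_gt_of_ne hua with h | h
        · left; exact ⟨h.le, by nlinarith⟩
        · right; exact ⟨by nlinarith, h.le⟩
      have := intermediate_value_uIcc (f := u) (a := a) (b := x)
        (by rw [Set.uIcc_of_le hx.1]; exact hcont.mono hsub)
      obtain ⟨y, hy, hy0⟩ := this h0
      rw [Set.uIcc_of_le hx.1] at hy
      exact hne y (hsub hy) hy0
    exact ⟨h b (Set.right_mem_Icc.mpr hab), fun x hx => (h x hx).le⟩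
  -- Wronskian with `sin (ω (x - a))`, times `u a` to fix the sign. It is decreasing, yet `W a = -ω
  -- u(a)² < 0 < ω u(a) u(b) = W b`.
  set W : ℝ → ℝ := fun x =>
    u a * (v x * Real.sin (ω * (x - a)) - u x * (ω * Real.cos (ω * (x - a))))
  have hW : ∀ x ∈ Set.Icc a b,
      HasDerivAt W ((ω ^ 2 - q x) * (u a * u x) * Real.sin (ω * (x - a))) x := by
    intro x hx
    have hl : HasDerivAt (fun y : ℝ => ω * (y - a)) ω x := by
      simpa using ((hasDerivAt_id x).sub_const a).const_mul ω
    have h := (((hv x hx).mul hl.sin).sub ((hu x hx).mul (hl.cos.const_mul ω))).const_mul (u a)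
    refine HasDerivAt.congr_deriv (h) ?_
    ring
  have hanti : AntitoneOn W (Set.Icc a b) := by
    refine antitoneOn_of_deriv_nonpos (convex_Icc a b)
      (fun x hx => (hW x hx).continuousAt.continuousWithinAt) ?_ ?_
    · exact fun x hx =>
        (hW x (interior_subset hx)).differentiableAt.differentiableWithinAt
    · intro x hx
      have hx := interior_subset hx
      rw [(hW x hx).deriv]
      have hs : 0 ≤ Real.sin (ω * (x - a)) := by
        refine Real.sin_nonneg_of_nonneg_of_le_pi (mul_nonneg hω.le (by linarith [hx.1])) ?_
        have : x - a ≤ Real.pi / ω := by linarith [hx.2]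
        rwa [le_div_iff₀' hω] at this
      exact mul_nonpos_of_nonpos_of_nonneg
        (mul_nonpos_of_nonpos_of_nonneg (by linarith [hq x hx]) (hsign.2 x hx)) hs
  have hle := hanti (Set.left_mem_Icc.mpr hab) (Set.right_mem_Icc.mpr hab) hab
  have hbb : ω * (b - a) = Real.pi := by rw [hb]; field_simp; ring
  simp only [W, hbb, sub_self, mul_zero, Real.sin_zero, Real.cos_zero, Real.sin_pi,
    Real.cos_pi] at hle
  have h1 := hsign.1
  have h2 := hsign.2 a (Set.left_mem_Icc.mpr hab)
  have h3 := mul_pos h1 hω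
  have h4 := mul_nonneg h2 hω.le
  linarith

/-! ### Location and spacing of Bessel zeros -/

lemma besselNormal_zero {ν : ℝ} (hν : 0 ≤ ν) : besselNormal ν 0 = 0 := by
  rw [besselNormal, Real.zero_rpow (by positivity), zero_mul]

/-- For `ν ≥ 1/2`, distinct zeros of the normal form on `[0, ∞)` are at least `π` apart. -/
lemma pi_le_gap {ν a b : ℝ} (hν : 1 / 2 ≤ ν) (ha : 0 ≤ a) (hab : a < b)
    (hua : besselNormal ν a = 0) (hub : besselNormal ν b = 0) : a + Real.pi ≤ b := by
  by_contra! hlt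
  have hν0 : 0 ≤ ν := by linarith
  -- The Riccati function is `cot (x - c)`, with `r' + r² = -1`; the shift by `c` keeps it regular
  -- on all of `[a, b]`.
  obtain ⟨c, hca, hcb⟩ : ∃ c, c < a ∧ b - Real.pi < c :=
    ⟨(a + (b - Real.pi)) / 2, by linarith, by linarith⟩
  have hs : ∀ x ∈ Set.Icc a b, 0 < Real.sin (x - c) := fun x hx =>
    Real.sin_pos_of_pos_of_lt_pi (by linarith [hx.1]) (by linarith [hx.2])
  refine besselNormalDeriv_ne_zero hν0 (ha.trans_lt hab) hub
    (no_two_zeros_of_riccati (v := besselNormalDeriv ν)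
      (q := fun x => 1 - (ν ^ 2 - 1 / 4) / x ^ 2)
      (r := fun x => Real.cos (x - c) / Real.sin (x - c))
      (r' := fun x => -1 - (Real.cos (x - c) / Real.sin (x - c)) ^ 2)
      hab (continuous_besselNormal hν0).continuousOn (continuous_besselNormalDeriv hν).continuousOn
      (ContinuousOn.div (by fun_prop) (by fun_prop) fun x hx => (hs x hx).ne')
      (fun x hx => hasDerivAt_besselNormal hν0 (ha.trans_lt hx.1))
      (fun x hx => hasDerivAt_besselNormalDeriv hν0 (ha.trans_lt hx.1))
      (fun x hx => ?_) (fun x hx => ?_) hua hub)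
  · have hsx := hs x ⟨hx.1.le, hx.2⟩
    have hl : HasDerivAt (fun y : ℝ => y - c) 1 x := (hasDerivAt_id x).sub_const c
    refine (hl.cos.div hl.sin hsx.ne').congr_deriv ?_
    field_simp
  · have : 0 ≤ (ν ^ 2 - 1 / 4) / x ^ 2 := div_nonneg (by nlinarith) (sq_nonneg x)
    linarith

/-- Positive zeros of `J_ν` lie beyond the turning point `x² = ν² - 1/4`. -/
lemma turning_point_lt_sq {ν b : ℝ} (hν : 1 / 2 ≤ ν) (hb : 0 < b)
    (hub : besselNormal ν b = 0) : ν ^ 2 - 1 / 4 < b ^ 2 := by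
  by_contra! hle
  have hν0 : 0 ≤ ν := by linarith
  refine besselNormalDeriv_ne_zero hν0 hb hub
    (no_two_zeros_of_riccati (v := besselNormalDeriv ν)
      (q := fun x => 1 - (ν ^ 2 - 1 / 4) / x ^ 2) (r := fun _ => 0) (r' := fun _ => 0)
      hb (continuous_besselNormal hν0).continuousOn (continuous_besselNormalDeriv hν).continuousOn
      continuousOn_const
      (fun x hx => hasDerivAt_besselNormal hν0 hx.1)
      (fun x hx => hasDerivAt_besselNormalDeriv hν0 hx.1)
      (fun x _ => hasDerivAt_const x 0) (fun x hx => ?_) (besselNormal_zero hν0) hub)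
  have hx2 : 0 < x ^ 2 := pow_pos hx.1 2
  have : 1 ≤ (ν ^ 2 - 1 / 4) / x ^ 2 := by
    rw [le_div_iff₀ hx2]
    nlinarith [hx.1, hx.2]
  linarith

lemma exists_besselNormal_zero {ν a ω : ℝ} (hν : 0 ≤ ν) (hω : 0 < ω) (ha : 0 < a)
    (hq : ∀ x, a ≤ x → ω ^ 2 ≤ 1 - (ν ^ 2 - 1 / 4) / x ^ 2) :
    ∃ x, a ≤ x ∧ x ≤ a + Real.pi / ω ∧ besselNormal ν x = 0 := by
  obtain ⟨x, hx, h⟩ := exists_zero_of_le_potential (u := besselNormal ν)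
    (v := besselNormalDeriv ν) (q := fun x => 1 - (ν ^ 2 - 1 / 4) / x ^ 2) (a := a) hω
    (fun x hx => hasDerivAt_besselNormal hν (ha.trans_le hx.1))
    (fun x hx => hasDerivAt_besselNormalDeriv hν (ha.trans_le hx.1))
    (fun x hx => hq x hx.1)
  exact ⟨x, hx.1, hx.2, h⟩

lemma exists_besselNormal_zero_of_large {ν ω : ℝ} (hν : 0 ≤ ν) (hω : 0 < ω) (hω1 : ω < 1) :
    ∃ X : ℝ, 0 < X ∧ ∀ a, X ≤ a →
      ∃ x, a ≤ x ∧ x ≤ a + Real.pi / ω ∧ besselNormal ν x = 0 := by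
  have h1 : 0 < 1 - ω ^ 2 := by nlinarith
  have h2 : 0 ≤ ν ^ 2 / (1 - ω ^ 2) := by positivity
  -- The summand `1` gives `x ≤ x²`, which avoids a square root in the threshold.
  refine ⟨1 + ν ^ 2 / (1 - ω ^ 2), by positivity, fun a ha => ?_⟩
  refine exists_besselNormal_zero hν hω (by linarith) fun x hx => ?_
  have hx1 : 1 ≤ x := by linarith
  have hx2 : 0 < x ^ 2 := by positivity
  have h3 : ν ^ 2 / (1 - ω ^ 2) ≤ x ^ 2 := by nlinarith
  rw [div_le_iff₀ h1] at h3
  have : (ν ^ 2 - 1 / 4) / x ^ 2 ≤ 1 - ω ^ 2 := by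
    rw [div_le_iff₀ hx2]
    linarith
  linarith

/-- The zero following `a` among the zeros of the normal form on `[0, ∞)`. -/
lemma exists_next_zero {ν a : ℝ} (hν : 1 / 2 ≤ ν) (ha : 0 ≤ a) (hua : besselNormal ν a = 0) :
    ∃ z, a + Real.pi ≤ z ∧ besselNormal ν z = 0 ∧
      ∀ y, a < y → besselNormal ν y = 0 → z ≤ y := by
  have hν0 : 0 ≤ ν := by linarith
  -- Starting at `a + π` makes the set closed, and by `pi_le_gap` it misses no zero beyond `a`.
  set S : Set ℝ := {x | a + Real.pi ≤ x ∧ besselNormal ν x = 0}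
  have hclosed : IsClosed S := by
    have h1 : IsClosed {x : ℝ | a + Real.pi ≤ x} := isClosed_Ici
    exact h1.inter (isClosed_eq (continuous_besselNormal hν0) continuous_const)
  have hbdd : BddBelow S := ⟨a + Real.pi, fun x hx => hx.1⟩
  have hne : S.Nonempty := by
    obtain ⟨X, -, h⟩ := exists_besselNormal_zero_of_large hν0 (ω := 1 / 2) (by norm_num)
      (by norm_num)
    obtain ⟨x, hx, -, h0⟩ := h (max X (a + Real.pi)) (le_max_left _ _)
    exact ⟨x, (le_max_right _ _).trans hx, h0⟩
  have hmem := hclosed.csInf_mem hne hbdd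
  exact ⟨sInf S, hmem.1, hmem.2, fun y hay hy =>
    csInf_le hbdd ⟨pi_le_gap hν ha hay hua hy, hy⟩⟩

/-! ### Enumeration of the zeros -/

/-- Induction from the zero at the origin, which is not counted in `besselZeros`. The upper bound is
on `max z X` because gaps are controlled only beyond `X`; each step adds at most `L`. -/
lemma exists_nth_zero {ν : ℝ} (hν : 1 / 2 ≤ ν) {X L : ℝ} (hX : 0 < X)
    (hL : ∀ a, X ≤ a → ∃ x, a < x ∧ x ≤ a + L ∧ besselNormal ν x = 0) (n : ℕ) :
    ∃ z, besselNormal ν z = 0 ∧ (besselZeros ν ∩ Set.Iic z).Finite ∧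
      (besselZeros ν ∩ Set.Iic z).ncard = n ∧ Real.pi * n ≤ z ∧ max z X ≤ X + n * L := by
  induction n with
  | zero =>
    have hempty : besselZeros ν ∩ Set.Iic 0 = ∅ := by
      ext x
      simp only [Set.mem_inter_iff, Set.mem_Iic, Set.mem_empty_iff_false, iff_false]
      exact fun h => absurd h.1.1 (not_lt.mpr h.2)
    exact ⟨0, besselNormal_zero (by linarith), by simp [hempty], by simp [hempty], by simp,
      by simp [hX.le]⟩
  | succ n ih =>
    obtain ⟨a, hua, hfin, hcard, hlow, hup⟩ := ih
    have ha : 0 ≤ a := le_trans (by positivity) hlow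
    obtain ⟨z, haz, huz, hmin⟩ := exists_next_zero hν ha hua
    have hpi := Real.pi_pos
    have haz' : a < z := by linarith
    have hset : besselZeros ν ∩ Set.Iic z = insert z (besselZeros ν ∩ Set.Iic a) := by
      ext x
      simp only [Set.mem_inter_iff, Set.mem_Iic, Set.mem_insert_iff, mem_besselZeros_iff]
      constructor
      · rintro ⟨⟨hx, hux⟩, hxz⟩
        rcases le_or_gt x a with h | h
        · exact Or.inr ⟨⟨hx, hux⟩, h⟩
        · exact Or.inl (le_antisymm hxz (hmin x h hux))
      · rintro (rfl | ⟨⟨hx, hux⟩, hxa⟩)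
        · exact ⟨⟨ha.trans_lt haz', huz⟩, le_rfl⟩
        · exact ⟨⟨hx, hux⟩, hxa.trans haz'.le⟩
    refine ⟨z, huz, hset ▸ hfin.insert z, ?_, by push_cast; linarith, ?_⟩
    · rw [hset, Set.ncard_insert_of_notMem (fun h => absurd h.2 (not_le.mpr haz')) hfin, hcard]
    · obtain ⟨x, hx, hxL, hux⟩ := hL (max a X) (le_max_right _ _)
      have h1 := hmin x ((le_max_left _ _).trans_lt hx) hux
      have h2 : X ≤ x := (le_max_right a X).trans hx.le
      push_cast
      refine max_le ?_ ?_ <;> linarith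

lemma exists_isBesselZero {ν ε : ℝ} (hν : 1 / 2 ≤ ν) (hε : 0 < ε) :
    ∃ X : ℝ, ∀ n : ℕ, 1 ≤ n → ∃ z, IsBesselZero ν n z ∧ Real.pi * n ≤ z ∧
      z ≤ X + n * (Real.pi + ε) := by
  have hpi := Real.pi_pos
  obtain ⟨X, hX, h⟩ := exists_besselNormal_zero_of_large (ν := ν) (by linarith)
    -- Here `π / ω = π + ε/2`; the other `ε/2` makes the next zero lie strictly beyond `a`.
    (ω := Real.pi / (Real.pi + ε / 2)) (by positivity)
    (by rw [div_lt_one (by positivity)]; linarith)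
  have hL : ∀ a, X ≤ a → ∃ x, a < x ∧ x ≤ a + (Real.pi + ε) ∧ besselNormal ν x = 0 := by
    intro a ha
    obtain ⟨x, h1, h2, h3⟩ := h (a + ε / 2) (by linarith)
    rw [div_div_cancel₀ hpi.ne'] at h2
    exact ⟨x, by linarith, by linarith, h3⟩
  refine ⟨X, fun n hn => ?_⟩
  obtain ⟨z, hz, -, hcard, hlow, hup⟩ := exists_nth_zero hν hX hL n
  have hn' : (1 : ℝ) ≤ n := by exact_mod_cast hn
  have hz0 : 0 < z := by nlinarith
  exact ⟨z, ⟨mem_besselZeros_iff.mpr ⟨hz0, hz⟩, hcard⟩, hlow, (le_max_left _ _).trans hup⟩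

lemma isBesselZero_besselZero {ν : ℝ} (hν : 1 / 2 ≤ ν) {n : ℕ} (hn : 1 ≤ n) :
    IsBesselZero ν n (besselZero ν n) := by
  obtain ⟨X, h⟩ := exists_isBesselZero hν one_pos
  obtain ⟨z, hz, -⟩ := h n hn
  rwa [hz.besselZero_eq hn]

lemma pi_mul_le_besselZero {ν : ℝ} (hν : 1 / 2 ≤ ν) {n : ℕ} (hn : 1 ≤ n) :
    Real.pi * n ≤ besselZero ν n := by
  obtain ⟨X, h⟩ := exists_isBesselZero hν one_pos
  obtain ⟨z, hz, hlow, -⟩ := h n hn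
  rwa [hz.besselZero_eq hn]

lemma exists_besselZero_le {ν ε : ℝ} (hν : 1 / 2 ≤ ν) (hε : 0 < ε) :
    ∃ X : ℝ, ∀ n : ℕ, 1 ≤ n → besselZero ν n ≤ X + n * (Real.pi + ε) := by
  obtain ⟨X, h⟩ := exists_isBesselZero hν hε
  refine ⟨X, fun n hn => ?_⟩
  obtain ⟨z, hz, -, hup⟩ := h n hn
  rwa [hz.besselZero_eq hn]

/-- The turning point settles large `d`; for small `d` the bound `j ≥ π > 3` suffices. The constant
`1/6` is not sharp. -/
lemma dim_le_besselZero {d n : ℕ} (hd : 3 ≤ d) (hn : 1 ≤ n) :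
    (d : ℝ) / 6 ≤ besselZero ((d : ℝ) / 2 - 1) n := by
  have hd' : (3 : ℝ) ≤ d := by exact_mod_cast hd
  have hν : 1 / 2 ≤ (d : ℝ) / 2 - 1 := by linarith
  obtain ⟨hpos, h0⟩ := mem_besselZeros_iff.mp (isBesselZero_besselZero hν hn).1
  have hturn := turning_point_lt_sq hν hpos h0
  have hpi := pi_mul_le_besselZero hν hn
  have hn' : (1 : ℝ) ≤ n := by exact_mod_cast hn
  have h3 : 3 ≤ besselZero ((d : ℝ) / 2 - 1) n := by nlinarith [Real.pi_gt_three]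
  by_contra! hlt
  nlinarith

/-- The first positive zero of `J_0` exists and is at least `2`. -/
lemma two_le_besselZero_zero_one : 2 ≤ besselZero 0 1 := by
  -- The spacing bound needs `ν ≥ 1/2`; here positivity of the series for `x²/4 < 1` replaces it.
  have hlow : ∀ x, 0 < x → besselNormal 0 x = 0 → 2 ≤ x := by
    intro x hx h0
    by_contra! hlt
    rw [besselNormal_eq_zero_iff hx] at h0
    exact (besselSeries_pos le_rfl (by positivity) (by nlinarith)).ne' h0
  set S : Set ℝ := {x | 2 ≤ x ∧ besselNormal 0 x = 0}
  have hclosed : IsClosed S := by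
    have h1 : IsClosed {x : ℝ | 2 ≤ x} := isClosed_Ici
    exact h1.inter (isClosed_eq (continuous_besselNormal le_rfl) continuous_const)
  have hbdd : BddBelow S := ⟨2, fun x hx => hx.1⟩
  have hne : S.Nonempty := by
    obtain ⟨x, hx, -, h0⟩ := exists_besselNormal_zero (a := 2) (le_refl (0 : ℝ)) one_pos two_pos
      fun x hx => by
        have : 0 ≤ 1 / 4 / x ^ 2 := by positivity
        rw [show ((0 : ℝ) ^ 2 - 1 / 4) / x ^ 2 = -(1 / 4 / x ^ 2) by ring]
        linarith
    exact ⟨x, hx, h0⟩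
  have hmem := hclosed.csInf_mem hne hbdd
  have hpos : 0 < sInf S := two_pos.trans_le hmem.1
  have hz : IsBesselZero 0 1 (sInf S) := by
    refine ⟨mem_besselZeros_iff.mpr ⟨hpos, hmem.2⟩, ?_⟩
    rw [Set.ncard_eq_one]
    refine ⟨sInf S, ?_⟩
    ext x
    simp only [Set.mem_inter_iff, Set.mem_Iic, Set.mem_singleton_iff, mem_besselZeros_iff]
    constructor
    · rintro ⟨⟨hx, h0⟩, hle⟩
      exact le_antisymm hle (csInf_le hbdd ⟨hlow x hx h0, h0⟩)
    · rintro rfl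
      exact ⟨⟨hpos, hmem.2⟩, le_rfl⟩
  rw [hz.besselZero_eq le_rfl]
  exact hmem.1

/-! ### Bounds for `c(k,d)` -/

/-- The square root of the denominator of `krogerBound`. -/
noncomputable def krogerDenom (k d : ℕ) : ℝ :=
  if d = 2 then 2 * besselZero 0 1 + Real.pi * ((k : ℝ) - 1)
  else if Odd k then 2 * besselZero ((d : ℝ) / 2 - 1) ((k + 1) / 2)
  else besselZero ((d : ℝ) / 2 - 1) (k / 2) + besselZero ((d : ℝ) / 2 - 1) (k / 2 + 1)

lemma krogerBound_eq (k d : ℕ) :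
    krogerBound k d = Real.pi ^ 2 * (k : ℝ) ^ 2 / krogerDenom k d ^ 2 := by
  unfold krogerBound krogerDenom
  split_ifs
  · rfl
  · rw [mul_pow]
    norm_num
  · rfl

lemma half_le_of_three_le {d : ℕ} (hd : 3 ≤ d) : 1 / 2 ≤ (d : ℝ) / 2 - 1 := by
  have hd' : (3 : ℝ) ≤ d := by exact_mod_cast hd
  linarith

lemma pi_mul_lt_krogerDenom {k d : ℕ} (hk : 1 ≤ k) (hd : 2 ≤ d) :
    Real.pi * k < krogerDenom k d := by
  have hpi := Real.pi_pos
  unfold krogerDenom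
  split_ifs with h2 hodd
  · linarith [two_le_besselZero_zero_one, Real.pi_lt_four]
  · obtain ⟨m, rfl⟩ := hodd
    rw [show (2 * m + 1 + 1) / 2 = m + 1 by omega]
    have h := pi_mul_le_besselZero (half_le_of_three_le (show 3 ≤ d by omega))
      (show 1 ≤ m + 1 by omega)
    push_cast at h ⊢
    linarith
  · obtain ⟨m, rfl⟩ := Nat.not_odd_iff_even.mp hodd
    rw [show (m + m) / 2 = m by omega]
    have hν := half_le_of_three_le (show 3 ≤ d by omega)
    have h := pi_mul_le_besselZero hν (show 1 ≤ m by omega)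
    have h' := pi_mul_le_besselZero hν (show 1 ≤ m + 1 by omega)
    push_cast at h' ⊢
    linarith

lemma exists_krogerDenom_le {d : ℕ} (hd : 2 ≤ d) {ε : ℝ} (hε : 0 < ε) :
    ∃ X : ℝ, ∀ k : ℕ, 1 ≤ k → krogerDenom k d ≤ X + k * (Real.pi + ε) := by
  have hpi := Real.pi_pos
  by_cases h2 : d = 2
  · refine ⟨2 * besselZero 0 1, fun k _ => ?_⟩
    have : 0 ≤ (k : ℝ) * ε := by positivity
    simp only [krogerDenom, if_pos h2]
    linarith
  · obtain ⟨X, hX⟩ := exists_besselZero_le (half_le_of_three_le (show 3 ≤ d by omega)) hε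
    -- The two indices add up to `k + 1`, whence one extra `π + ε`.
    refine ⟨2 * X + (Real.pi + ε), fun k hk => ?_⟩
    simp only [krogerDenom, if_neg h2]
    split_ifs with hodd
    · obtain ⟨m, rfl⟩ := hodd
      rw [show (2 * m + 1 + 1) / 2 = m + 1 by omega]
      have h := hX (m + 1) (by omega)
      push_cast at h ⊢
      linarith
    · obtain ⟨m, rfl⟩ := Nat.not_odd_iff_even.mp hodd
      rw [show (m + m) / 2 = m by omega]
      have h := hX m (by omega)
      have h' := hX (m + 1) (by omega)
      push_cast at h' ⊢
      linarith

lemma krogerBound_lt_one {k d : ℕ} (hk : 1 ≤ k) (hd : 2 ≤ d) : krogerBound k d < 1 := by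
  have hlt := pi_mul_lt_krogerDenom hk hd
  have h0 : 0 ≤ Real.pi * k := by positivity
  rw [krogerBound_eq, ← mul_pow, ← div_pow]
  exact pow_lt_one₀ (div_nonneg h0 (h0.trans hlt.le))
    ((div_lt_one (h0.trans_lt hlt)).mpr hlt) two_ne_zero

lemma tendsto_krogerDenom_div {d : ℕ} (hd : 2 ≤ d) :
    Filter.Tendsto (fun k : ℕ => krogerDenom k d / k) Filter.atTop (nhds Real.pi) := by
  rw [Metric.tendsto_atTop]
  intro ε hε
  obtain ⟨X, hX⟩ := exists_krogerDenom_le hd (half_pos hε)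
  obtain ⟨N, hN⟩ := exists_nat_gt (X / (ε / 2))
  refine ⟨N + 1, fun k hk => ?_⟩
  have hk1 : 1 ≤ k := by omega
  have hk0 : (0 : ℝ) < k := by exact_mod_cast hk1
  have hNk : (N : ℝ) ≤ k := by exact_mod_cast (by omega : N ≤ k)
  have h1 : Real.pi < krogerDenom k d / k :=
    (lt_div_iff₀ hk0).mpr (pi_mul_lt_krogerDenom hk1 hd)
  have h2 : krogerDenom k d / k < Real.pi + ε := by
    rw [div_lt_iff₀ hk0]
    rw [div_lt_iff₀ (half_pos hε)] at hN
    nlinarith [hX k hk1]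
  rw [Real.dist_eq, abs_lt]
  constructor <;> linarith

lemma tendsto_krogerBound {d : ℕ} (hd : 2 ≤ d) :
    Filter.Tendsto (fun k : ℕ => krogerBound k d) Filter.atTop (nhds 1) := by
  have hpi := Real.pi_ne_zero
  have h := ((tendsto_const_nhds (x := Real.pi)).div (tendsto_krogerDenom_div hd) hpi).pow 2
  rw [div_self hpi, one_pow] at h
  refine h.congr' ?_
  filter_upwards [Filter.eventually_ge_atTop 1] with k hk
  have hk0 : (k : ℝ) ≠ 0 := by positivity
  rw [krogerBound_eq, Pi.div_apply, div_div_eq_mul_div, div_pow, mul_pow]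

/-- For `d ≥ 3`, `D ≥ d/3` gives the term `9π²k²`; the summand `4` covers `d = 2`, where `c < 1 =
4/d²`. -/
lemma krogerBound_le_div_sq {k d : ℕ} (hk : 1 ≤ k) (hd : 2 ≤ d) :
    krogerBound k d ≤ (9 * Real.pi ^ 2 * (k : ℝ) ^ 2 + 4) / (d : ℝ) ^ 2 := by
  have hd0 : (0 : ℝ) < d := by exact_mod_cast (by omega : 0 < d)
  by_cases h2 : d = 2
  · subst h2
    refine (krogerBound_lt_one hk hd).le.trans ?_
    rw [le_div_iff₀ (by positivity)]
    have : 0 ≤ 9 * Real.pi ^ 2 * (k : ℝ) ^ 2 := by positivity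
    push_cast
    linarith
  · have hD : (d : ℝ) / 3 ≤ krogerDenom k d := by
      simp only [krogerDenom, if_neg h2]
      split_ifs with hodd
      · have := dim_le_besselZero (show 3 ≤ d by omega) (show 1 ≤ (k + 1) / 2 by omega)
        linarith
      · obtain ⟨m, rfl⟩ := Nat.not_odd_iff_even.mp hodd
        have h := dim_le_besselZero (show 3 ≤ d by omega) (show 1 ≤ (m + m) / 2 by omega)
        have h' := dim_le_besselZero (show 3 ≤ d by omega) (show 1 ≤ (m + m) / 2 + 1 by omega)
        linarith
    rw [krogerBound_eq]
    calc Real.pi ^ 2 * (k : ℝ) ^ 2 / krogerDenom k d ^ 2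
        ≤ Real.pi ^ 2 * (k : ℝ) ^ 2 / ((d : ℝ) / 3) ^ 2 := by gcongr
      _ = 9 * Real.pi ^ 2 * (k : ℝ) ^ 2 / (d : ℝ) ^ 2 := by field_simp; ring
      _ ≤ _ := by gcongr; linarith

theorem proposition3p1 :
    (∀ k d : ℕ, 1 ≤ k → 2 ≤ d → krogerBound k d < 1) ∧
    (∀ d : ℕ, 2 ≤ d →
      Filter.Tendsto (fun k : ℕ => krogerBound k d) Filter.atTop (nhds 1)) ∧
    (∀ k : ℕ, 1 ≤ k → ∃ C : ℝ, 0 < C ∧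
      ∀ d : ℕ, 2 ≤ d → krogerBound k d ≤ C / (d : ℝ) ^ 2) :=
  ⟨fun _ _ hk hd => krogerBound_lt_one hk hd, fun _ hd => tendsto_krogerBound hd,
    fun k hk => ⟨9 * Real.pi ^ 2 * (k : ℝ) ^ 2 + 4, by positivity,
      fun _ hd => krogerBound_le_div_sq hk hd⟩⟩
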